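/- For a finite tree $T$, write $|T|$ for its number of vertices, $V(T)$ for its vertex set and $d(v)$ for the degree in $T$ of a vertex $v$. For a tree $S$, let $c(S,T)$ be the number of subsets of $V(T)$ whose induced subgraph in $T$ is isomorphic to $S$. For $k\ge 4$, let $Z_k(T)$ be the number of $k$-element subsets of $V(T)$ whose induced subgraph is a tree, let $P_k$ and $S_k$ be the path and the star with $k$ vertices, and set $$p_1^{(k)}(T)=\frac{c(P_k,T)}{Z_k(T)},\qquad p_2^{(k)}(T)=\frac{c(S_k,T)}{Z_k(T)}$$ (these are well defined when $|T|\ge k$). **Theorem.** Let $T_1,T_2,\ldots$ be a sequence of finite trees such that $|T_n|\to\infty$ as $n\to\infty$. For every integer $k\ge 4$, the following four statements are equivalent: - (M1) $\displaystyle\lim_{n\to\infty}p_1^{(k)}(T_n)=0$; - (M2) $\displaystyle\lim_{n\to\infty}\frac1{|T_n|}Z_k(T_n)=\infty$; - (M3) $\displaystyle\lim_{n\to\infty}\frac1{|T_n|}\sum_{v\in V(T_n)}d(v)^{k-1}=\infty$; - (M4) $\displaystyle\lim_{n\to\infty}p_2^{(k)}(T_n)=1$. In particular, if $p_1^{(k)}(T_n)\to0$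 then $p_2^{(k)}(T_n)\to1$. -/

import Mathlib

open Filter Topology

namespace TreeProfile

open Classical in
/-- `copies S T` is the number `c(S, T)` of copies of `S` in `T`: the number of sets of vertices
of `T` whose induced subgraph is isomorphic to `S`. -/
noncomputable def copies {U V : Type*} [Fintype V] (S : SimpleGraph U) (T : SimpleGraph V) : ℕ :=
  (Finset.univ.filter fun W : Finset V =>
    Nonempty (T.induce (W : Set V) ≃g S)).card

open Classical in
/-- `numSubtrees k T` is the number `Z_k(T)` of `k`-vertex subtrees of `T`: the number of sets of
`k` vertices of `T` whose induced subgraph is a tree. -/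
noncomputable def numSubtrees {V : Type*} [Fintype V] (k : ℕ) (T : SimpleGraph V) : ℕ :=
  (Finset.univ.filter fun W : Finset V =>
    W.card = k ∧ (T.induce (W : Set V)).IsTree).card

/-- The path with `k` vertices. -/
abbrev path (k : ℕ) : SimpleGraph (Fin k) := SimpleGraph.pathGraph k

/-- The star with `k` vertices (for `1 ≤ k`): a centre, `none`, joined to `k - 1` leaves. -/
abbrev star (k : ℕ) : SimpleGraph (Option (Fin (k - 1))) := SimpleGraph.starGraph none

/-- The proportion of copies of `S` among the `k`-vertex subtrees of `T` (where `S` is a `k`-vertex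
tree). -/
noncomputable def proportion {U V : Type*} [Fintype V] (k : ℕ) (S : SimpleGraph U)
    (T : SimpleGraph V) : ℝ :=
  (copies S T : ℝ) / (numSubtrees k T : ℝ)

/-- The proportion `p₁` of paths among the `k`-vertex subtrees of `T`. -/
noncomputable def pathProportion {V : Type*} [Fintype V] (k : ℕ) (T : SimpleGraph V) : ℝ :=
  proportion k (path k) T

/-- The proportion `p₂` of stars among the `k`-vertex subtrees of `T`. -/
noncomputable def starProportion {V : Type*} [Fintype V] (k : ℕ) (T : SimpleGraph V) : ℝ :=
  proportion k (star k) T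

end TreeProfile

/-! The implications are proved in a cycle; write N for the number of vertices and M for the sum of
d(v)^(k-1).

(M1) to (M2): suppose Z_k ≤ bN for infinitely many trees. Along these M, and so the sum of d(v)^2,
is O(N), while there are only o(N) paths. The vertices of these paths and a root form a set of size
o(N) within bounded distance of every vertex (`exists_thickening_eq_univ`). By Cauchy–Schwarz,
boundedly many thickenings keep such a set at size o(N), a contradiction.

(M2) to (M3): growing subtrees from a vertex of maximal degree gives Z_k = O(M) (`numSubtrees_le`).

(M3) to (M4): M is at most a constant times the number of stars plus O(N) (`sum_degree_pow_le`), so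
M = O(Z_k) eventually. A non-star contains a path v, w, x with d(w) ≤ d(v) and d(v) maximal, which
costs a factor d(w)d(v)^(k-3) summed over such edges. Weighting this product by K and charging edges
to their ends farther from a root bounds K times the number of non-stars by O(M) + O_K(N)
(`mul_numNonstars_le`).

(M4) to (M1): for k ≥ 4 paths are not stars. -/

namespace TreeProfile

/-! ### Counting connected vertex sets of bounded degree -/

/-- A connected induced subgraph has an edge leaving each nonempty proper subset of its vertices. -/
lemma exists_adj_of_induce_connected {V : Type*} {T : SimpleGraph V} {W A : Finset V}
    (hW : (T.induce (W : Set V)).Connected) (hAW : A ⊆ W) {a y : V} (ha : a ∈ A)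
    (hy : y ∈ W) (hyA : y ∉ A) : ∃ b ∈ A, ∃ x ∈ W, x ∉ A ∧ T.Adj b x := by
  obtain ⟨p⟩ := hW.preconnected ⟨a, hAW ha⟩ ⟨y, hy⟩
  obtain ⟨d, -, h1, h2⟩ := p.exists_boundary_dart {z | (z : V) ∈ A} ha hyA
  exact ⟨d.fst, h1, d.snd, d.snd.2, h2, d.adj⟩

open Classical in
/-- The connected vertex sets with `j` vertices besides those of `A`, all of degree at most `d`. -/
noncomputable def connectedExtensions {V : Type*} [Fintype V] (T : SimpleGraph V)
    [DecidableRel T.Adj] (d j : ℕ) (A : Finset V) : Finset (Finset V) :=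
  Finset.univ.filter fun W : Finset V => A ⊆ W ∧ W.card = A.card + j ∧
    (T.induce (W : Set V)).Connected ∧ ∀ x ∈ W, T.degree x ≤ d

lemma mem_connectedExtensions {V : Type*} [Fintype V] {T : SimpleGraph V}
    [DecidableRel T.Adj] {d j : ℕ} {A W : Finset V} :
    W ∈ connectedExtensions T d j A ↔ A ⊆ W ∧ W.card = A.card + j ∧
      (T.induce (W : Set V)).Connected ∧ ∀ x ∈ W, T.degree x ≤ d := by
  simp [connectedExtensions]

/-- Some edge leaves `A` inside the set: at most `k` choices for its end in `A` and `d` for the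
other end, which then joins `A`. -/
lemma card_connectedExtensions_le {V : Type*} [Fintype V] (T : SimpleGraph V)
    [DecidableRel T.Adj] (d k j : ℕ) : ∀ A : Finset V, A.Nonempty → A.card + j ≤ k →
      (connectedExtensions T d j A).card ≤ (k * d) ^ j := by
  classical
  induction j with
  | zero =>
    intro A _ _
    rw [pow_zero, Finset.card_le_one]
    intro W hW W' hW'
    rw [mem_connectedExtensions] at hW hW'
    rw [← Finset.eq_of_subset_of_card_le hW.1 (by omega),
      ← Finset.eq_of_subset_of_card_le hW'.1 (by omega)]
  | succ j ih =>
    intro A ⟨a, ha⟩ hcard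
    have hsub : connectedExtensions T d (j + 1) A ⊆
        (A.filter fun b => T.degree b ≤ d).biUnion fun b =>
          (T.neighborFinset b \ A).biUnion fun x => connectedExtensions T d j (insert x A) := by
      intro W hW
      rw [mem_connectedExtensions] at hW
      obtain ⟨hAW, hWc, hconn, hdeg⟩ := hW
      obtain ⟨y, hy, hyA⟩ : ∃ y ∈ W, y ∉ A := by
        by_contra! h
        have := Finset.card_le_card (show W ⊆ A from h)
        omega
      obtain ⟨b, hb, x, hx, hxA, hadj⟩ := exists_adj_of_induce_connected hconn hAW ha hy hyA
      simp only [Finset.mem_biUnion, Finset.mem_filter, Finset.mem_sdiff,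
        SimpleGraph.mem_neighborFinset, mem_connectedExtensions]
      refine ⟨b, ⟨hb, hdeg b (hAW hb)⟩, x, ⟨hadj, hxA⟩, Finset.insert_subset hx hAW, ?_,
        hconn, hdeg⟩
      rw [Finset.card_insert_of_notMem hxA]
      omega
    refine (Finset.card_le_card hsub).trans ?_
    refine (Finset.card_biUnion_le_card_mul _ _ (d * (k * d) ^ j) ?_).trans ?_
    · intro b hb
      refine (Finset.card_biUnion_le_card_mul _ _ ((k * d) ^ j) ?_).trans ?_
      · intro x hx
        apply ih _ (Finset.insert_nonempty _ _)
        rw [Finset.card_insert_of_notMem (Finset.mem_sdiff.1 hx).2]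
        omega
      · gcongr
        refine (Finset.card_le_card Finset.sdiff_subset).trans ?_
        rw [SimpleGraph.card_neighborFinset_eq_degree]
        exact (Finset.mem_filter.1 hb).2
    · have h1 := Finset.card_filter_le A fun b => T.degree b ≤ d
      calc _ ≤ k * (d * (k * d) ^ j) := by gcongr; omega
        _ = (k * d) ^ (j + 1) := by ring

lemma card_biUnion_connectedExtensions_le {V ι : Type*} [Fintype V] [DecidableEq V]
    (T : SimpleGraph V) [DecidableRel T.Adj] (d k j : ℕ) (s : Finset ι) (A : ι → Finset V)
    (hA : ∀ i ∈ s, (A i).Nonempty ∧ (A i).card + j ≤ k) :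
    (s.biUnion fun i => connectedExtensions T d j (A i)).card ≤ s.card * (k * d) ^ j :=
  Finset.card_biUnion_le_card_mul _ _ _ fun i hi =>
    card_connectedExtensions_le T d k j _ (hA i hi).1 (hA i hi).2

/-- The number of `k`-vertex subtrees is at most a constant multiple of the `(k-1)`-st moment
of the degrees. -/
lemma numSubtrees_le {V : Type*} [Fintype V] (T : SimpleGraph V) [DecidableRel T.Adj] {k : ℕ}
    (hk : 1 ≤ k) : numSubtrees k T ≤ k ^ (k - 1) * ∑ v, T.degree v ^ (k - 1) := by
  classical
  have hsub : (Finset.univ.filter fun W : Finset V =>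
      W.card = k ∧ (T.induce (W : Set V)).IsTree) ⊆
      Finset.univ.biUnion fun v => connectedExtensions T (T.degree v) (k - 1) {v} := by
    intro W hW
    obtain ⟨hc, ht⟩ := (Finset.mem_filter.1 hW).2
    obtain ⟨v, hv, hmax⟩ := W.exists_max_image (fun v => T.degree v)
      (Finset.card_pos.1 (by omega))
    simp only [Finset.mem_biUnion, Finset.mem_univ, true_and, mem_connectedExtensions]
    exact ⟨v, by simpa using hv, by simp; omega, ht.connected, hmax⟩
  have := (Finset.card_le_card hsub).trans Finset.card_biUnion_le
  rw [numSubtrees, Finset.mul_sum]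
  convert this.trans (Finset.sum_le_sum fun v _ => ?_)
  rw [← mul_pow]
  exact card_connectedExtensions_le T _ k _ _ (by simp) (by simp; omega)

/-! ### Stars and the degree moment -/

/-- A vertex of an acyclic graph together with some of its neighbours induces a star. -/
lemma induce_iso_star {V : Type*} {T : SimpleGraph V} (hT : T.IsAcyclic) {W : Finset V} {k : ℕ}
    (hc : W.card = k) {v : V} (hv : v ∈ W) (hadj : ∀ y ∈ W, y ≠ v → T.Adj v y) :
    Nonempty (T.induce (W : Set V) ≃g star k) := by
  classical
  have hcard : (W.erase v).card = k - 1 := by rw [Finset.card_erase_of_mem hv, hc]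
  let e : {y // y ∈ W.erase v} ≃ Fin (k - 1) := Finset.equivFinOfCardEq hcard
  have hnadj : ∀ x ∈ W, ∀ y ∈ W, x ≠ v → y ≠ v → ¬ T.Adj x y := by
    intro x hx y hy hxv hyv hxy
    refine hT.cliqueFree le_rfl {v, x, y} ?_
    rw [SimpleGraph.is3Clique_triple_iff]
    exact ⟨hadj x hx hxv, hadj y hy hyv, hxy⟩
  refine ⟨⟨⟨fun x => if h : (x : V) = v then none else some (e ⟨x, Finset.mem_erase.2 ⟨h, x.2⟩⟩),
    fun o => o.elim ⟨v, hv⟩ fun i => ⟨e.symm i, Finset.mem_of_mem_erase (e.symm i).2⟩, ?_, ?_⟩, ?_⟩⟩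
  · rintro ⟨x, hx⟩
    by_cases h : x = v <;> simp [h]
  · rintro (_ | i)
    · simp
    · have := Finset.ne_of_mem_erase (e.symm i).2
      simp [this]
  · rintro ⟨x, hx⟩ ⟨y, hy⟩
    have hx' : x ∈ W := hx
    have hy' : y ∈ W := hy
    by_cases h : x = v <;> by_cases h' : y = v
    · simp [h, h']
    · subst h; simp [h', hadj y hy' h']
    · subst h'; simp [h, (hadj x hx' h).symm]
    · simp [h, h', hnadj x hx' y hy' h h']

open Classical in
/-- The number of `k`-vertex subtrees that are not stars. -/
noncomputable def numNonstars {V : Type*} [Fintype V] (k : ℕ) (T : SimpleGraph V) : ℕ :=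
  (Finset.univ.filter fun W : Finset V => (W.card = k ∧ (T.induce (W : Set V)).IsTree) ∧
    ¬ Nonempty (T.induce (W : Set V) ≃g star k)).card

lemma card_eq_of_induce_iso {V U : Type*} [Fintype U] {T : SimpleGraph V} {S : SimpleGraph U}
    {W : Finset V} (h : Nonempty (T.induce (W : Set V) ≃g S)) : W.card = Fintype.card U := by
  obtain ⟨e⟩ := h
  simpa using Fintype.card_congr e.toEquiv

lemma copies_star_add_numNonstars {V : Type*} [Fintype V] (T : SimpleGraph V) {k : ℕ}
    (hk : 1 ≤ k) : copies (star k) T + numNonstars k T = numSubtrees k T := by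
  classical
  rw [numSubtrees, ← Finset.card_filter_add_card_filter_not (p := fun W : Finset V =>
    Nonempty (T.induce (W : Set V) ≃g star k)), Finset.filter_filter, Finset.filter_filter,
    numNonstars, copies]
  congr 2
  refine Finset.filter_congr fun W _ => ⟨fun h => ⟨⟨?_, ?_⟩, h⟩, fun h => h.2⟩
  · rw [card_eq_of_induce_iso h, Fintype.card_option, Fintype.card_fin]
    omega
  · exact h.some.isTree_iff.2 (SimpleGraph.isTree_starGraph _)

/-- The centre of the star has at least three neighbours, a vertex of a path at most two. -/
lemma not_path_iso_star {k : ℕ} (hk : 4 ≤ k) : IsEmpty (path k ≃g star k) := by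
  refine ⟨fun e => ?_⟩
  have key : ∀ i : Fin (k - 1), (path k).Adj (e.symm none) (e.symm (some i)) := fun i => by
    rw [e.symm.map_adj_iff]; simp
  have inj : ∀ i j : Fin (k - 1), (e.symm (some i)).val = (e.symm (some j)).val → i = j := by
    intro i j h
    simpa using e.symm.injective (Fin.ext h)
  have h0 := key ⟨0, by omega⟩
  have h1 := key ⟨1, by omega⟩
  have h2 := key ⟨2, by omega⟩
  have i1 := inj ⟨0, by omega⟩ ⟨1, by omega⟩
  have i2 := inj ⟨0, by omega⟩ ⟨2, by omega⟩
  have i3 := inj ⟨1, by omega⟩ ⟨2, by omega⟩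
  rw [SimpleGraph.pathGraph_adj] at h0 h1 h2
  simp only [Fin.mk.injEq] at i1 i2 i3
  omega

lemma copies_path_le_numNonstars {V : Type*} [Fintype V] {T : SimpleGraph V} (hT : T.IsAcyclic)
    {k : ℕ} (hk : 4 ≤ k) : copies (path k) T ≤ numNonstars k T := by
  classical
  refine Finset.card_le_card fun W hW => ?_
  obtain ⟨e⟩ := (Finset.mem_filter.1 hW).2
  refine Finset.mem_filter.2 ⟨Finset.mem_univ _, ⟨?_, ?_, hT.induce _⟩, fun ⟨e'⟩ => ?_⟩
  · rw [card_eq_of_induce_iso ⟨e⟩, Fintype.card_fin]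
  · obtain ⟨m, rfl⟩ : ∃ m, k = m + 1 := ⟨k - 1, by omega⟩
    exact e.connected_iff.2 (SimpleGraph.pathGraph_connected m)
  · exact (not_path_iso_star hk).false (e.symm.trans e')

/-- Stars are counted by choosing a centre and neighbours of it. -/
lemma sum_choose_le {V : Type*} [Fintype V] {T : SimpleGraph V} [DecidableRel T.Adj]
    (hT : T.IsAcyclic) {k : ℕ} (hk : 1 ≤ k) :
    ∑ v, (T.degree v).choose (k - 1) ≤ k * copies (star k) T := by
  classical
  -- Centres with leaf sets inject into stars with a marked vertex. The factor `k` avoids having to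
  -- show that a star determines its centre.
  let s : Finset (Σ _ : V, Finset V) :=
    Finset.univ.sigma fun v => (T.neighborFinset v).powersetCard (k - 1)
  let t : Finset (Σ _ : Finset V, V) := (Finset.univ.filter fun W : Finset V =>
    Nonempty (T.induce (W : Set V) ≃g star k)).sigma fun W => W
  have hs : s.card = ∑ v, (T.degree v).choose (k - 1) := by
    simp [s, Finset.card_sigma, Finset.card_powersetCard]
  have ht : t.card = k * copies (star k) T := by
    rw [Finset.card_sigma, Finset.sum_const_nat (m := k), mul_comm, copies]
    intro W hW
    rw [card_eq_of_induce_iso (Finset.mem_filter.1 hW).2, Fintype.card_option, Fintype.card_fin]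
    omega
  rw [← hs, ← ht]
  have hmem : ∀ x ∈ s, x.1 ∉ x.2 ∧ x.2.card = k - 1 ∧ ∀ y ∈ x.2, T.Adj x.1 y := by
    intro x hx
    obtain ⟨h1, h2⟩ := Finset.mem_powersetCard.1 (Finset.mem_sigma.1 hx).2
    exact ⟨fun h => by simpa using h1 h, h2, fun y hy => by simpa using h1 hy⟩
  refine Finset.card_le_card_of_injOn (fun x => ⟨insert x.1 x.2, x.1⟩) ?_ ?_
  · intro x hx
    obtain ⟨h1, h2, h3⟩ := hmem x hx
    refine Finset.mem_sigma.2 ⟨Finset.mem_filter.2 ⟨Finset.mem_univ _, ?_⟩,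
      Finset.mem_insert_self _ _⟩
    refine induce_iso_star hT ?_ (Finset.mem_insert_self x.1 x.2) fun y hy hne => ?_
    · rw [Finset.card_insert_of_notMem h1]; omega
    · exact h3 y ((Finset.mem_insert.1 hy).resolve_left hne)
  · rintro ⟨v, A⟩ hx ⟨v', A'⟩ hx' h
    have h1 := (hmem _ hx).1
    have h1' := (hmem _ hx').1
    simp only [Sigma.mk.injEq, heq_eq_eq] at h
    obtain ⟨h, rfl⟩ := h
    have : A = A' := by
      rw [← Finset.erase_insert (show v ∉ A from h1), h,
        Finset.erase_insert (show v ∉ A' from h1')]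
    rw [this]

/-- For `d ≥ 2 * m` each factor of the falling factorial is at least `d / 2`; smaller `d` are
absorbed by the additive constant. -/
lemma pow_le_choose_mul_add (d m : ℕ) :
    d ^ m ≤ 2 ^ m * m.factorial * d.choose m + (2 * m) ^ m := by
  rcases le_total d (2 * m) with h | h
  · exact (Nat.pow_le_pow_left h m).trans (Nat.le_add_left _ _)
  · refine le_trans ?_ (Nat.le_add_right _ _)
    rw [mul_assoc, ← Nat.descFactorial_eq_factorial_mul_choose]
    refine le_trans ?_ (Nat.mul_le_mul_left _ (Nat.pow_sub_le_descFactorial d m))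
    rw [← mul_pow]
    exact Nat.pow_le_pow_left (by omega) m

/-- The `(k-1)`-st moment of the degrees is bounded in terms of the number of stars. -/
lemma sum_degree_pow_le {V : Type*} [Fintype V] {T : SimpleGraph V} [DecidableRel T.Adj]
    (hT : T.IsAcyclic) {k : ℕ} (hk : 1 ≤ k) :
    ∑ v, T.degree v ^ (k - 1) ≤ 2 ^ (k - 1) * (k - 1).factorial * k * copies (star k) T +
      (2 * (k - 1)) ^ (k - 1) * Fintype.card V := by
  calc _ ≤ ∑ v, (2 ^ (k - 1) * (k - 1).factorial * (T.degree v).choose (k - 1) +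
        (2 * (k - 1)) ^ (k - 1)) := Finset.sum_le_sum fun v _ => pow_le_choose_mul_add _ _
    _ = 2 ^ (k - 1) * (k - 1).factorial * ∑ v, (T.degree v).choose (k - 1) +
        (2 * (k - 1)) ^ (k - 1) * Fintype.card V := by
      rw [Finset.sum_add_distrib, ← Finset.mul_sum]
      simp [mul_comm]
    _ ≤ _ := by
      rw [mul_assoc _ k]
      gcongr
      exact sum_choose_le hT hk

/-! ### Subtrees other than stars -/

/-- Every subtree other than a star contains a path `v, w, x` starting at a vertex `v` of
maximal degree. -/
lemma numNonstars_le {V : Type*} [Fintype V] {T : SimpleGraph V} [DecidableRel T.Adj]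
    (hT : T.IsAcyclic) (n : ℕ) :
    numNonstars (n + 3) T ≤ ∑ v, ∑ w ∈ (T.neighborFinset v).filter (T.degree · ≤ T.degree v),
      T.degree w * ((n + 3) * T.degree v) ^ n := by
  classical
  have hsub : (Finset.univ.filter fun W : Finset V =>
      (W.card = n + 3 ∧ (T.induce (W : Set V)).IsTree) ∧
        ¬ Nonempty (T.induce (W : Set V) ≃g star (n + 3))) ⊆
      Finset.univ.biUnion fun v =>
        ((T.neighborFinset v).filter (T.degree · ≤ T.degree v)).biUnion fun w =>
          ((T.neighborFinset w).erase v).biUnion fun x =>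
            connectedExtensions T (T.degree v) n {v, w, x} := by
    intro W hW
    obtain ⟨⟨hc, ht⟩, hns⟩ := (Finset.mem_filter.1 hW).2
    obtain ⟨v, hv, hmax⟩ := W.exists_max_image (fun v => T.degree v)
      (Finset.card_pos.1 (by omega))
    obtain ⟨y, hy, hyv, hvy⟩ : ∃ y ∈ W, y ≠ v ∧ ¬ T.Adj v y := by
      by_contra! h
      exact hns (induce_iso_star hT hc hv h)
    -- The edge leaves the closed neighbourhood of `v`, so `x` is not adjacent to `v` and hence `w ≠
    -- v`.
    obtain ⟨w, hw, x, hx, hxA, hwx⟩ := exists_adj_of_induce_connected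
      (A := W.filter fun z => z = v ∨ T.Adj v z) (a := v) (y := y) ht.connected
      (Finset.filter_subset _ _) (by simp [hv]) hy (by simp [hyv, hvy])
    simp only [Finset.mem_filter, hx, true_and, not_or] at hw hxA
    have hvw : T.Adj v w := by
      rcases hw.2 with rfl | h
      · exact absurd hwx hxA.2
      · exact h
    simp only [Finset.mem_biUnion, Finset.mem_univ, true_and, Finset.mem_filter,
      SimpleGraph.mem_neighborFinset, Finset.mem_erase, mem_connectedExtensions]
    refine ⟨v, w, ⟨hvw, hmax w hw.1⟩, x, ⟨hxA.1, hwx⟩, ?_, ?_, ht.connected, hmax⟩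
    · simp [Finset.insert_subset_iff, hv, hw.1, hx]
    · rw [Finset.card_eq_three.2 ⟨v, w, x, hvw.ne, Ne.symm hxA.1, hwx.ne, rfl⟩]
      omega
  have := (Finset.card_le_card hsub).trans Finset.card_biUnion_le
  rw [numNonstars]
  refine this.trans (Finset.sum_le_sum fun v _ => Finset.card_biUnion_le.trans
    (Finset.sum_le_sum fun w _ => ?_))
  refine (card_biUnion_connectedExtensions_le T _ (n + 3) n _ _ fun x _ => ⟨by simp, ?_⟩).trans ?_
  · have := Finset.card_le_three (a := v) (b := w) (c := x)
    omega
  · gcongr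
    rw [← SimpleGraph.card_neighborFinset_eq_degree]
    exact Finset.card_le_card (Finset.erase_subset _ _)

/-- In a tree, a vertex has at most one neighbour closer to a given root. -/
lemma eq_of_adj_of_dist_add_one {V : Type*} {T : SimpleGraph V} (hT : T.IsTree) {r v w w' : V}
    (h : T.Adj v w) (h' : T.Adj v w') (hd : T.dist v r = T.dist w r + 1)
    (hd' : T.dist v r = T.dist w' r + 1) : w = w' := by
  obtain ⟨q, hq⟩ := hT.connected.exists_walk_length_eq_dist w r
  obtain ⟨q', hq'⟩ := hT.connected.exists_walk_length_eq_dist w' r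
  have hp : (SimpleGraph.Walk.cons h q).IsPath :=
    SimpleGraph.Walk.isPath_of_length_eq_dist _ (by simp [hq, hd])
  have hp' : (SimpleGraph.Walk.cons h' q').IsPath :=
    SimpleGraph.Walk.isPath_of_length_eq_dist _ (by simp [hq', hd'])
  have := congrArg SimpleGraph.Walk.snd
    (congrArg Subtype.val ((hT.isAcyclic.subsingleton_path v r).elim ⟨_, hp⟩ ⟨_, hp'⟩))
  simpa using this

/-- Charge each edge to its end farther from a root: a weight monotone in the degree, summed over
the ends of smaller degree of all edges, is at most twice its sum over the vertices. -/
lemma sum_neighbor_degree_le {V : Type*} [Fintype V] {T : SimpleGraph V} [DecidableRel T.Adj]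
    (hT : T.IsTree) {f : ℕ → ℕ} (hf : Monotone f) :
    ∑ v, ∑ w ∈ (T.neighborFinset v).filter (T.degree · ≤ T.degree v), f (T.degree w) ≤
      2 * ∑ v, f (T.degree v) := by
  classical
  obtain ⟨r⟩ := hT.connected.nonempty
  have hparent : ∑ v, ∑ w, (if T.Adj v w ∧ T.dist v r = T.dist w r + 1 then f (T.degree v) else 0)
      ≤ ∑ v, f (T.degree v) := by
    refine Finset.sum_le_sum fun v _ => ?_
    rw [← Finset.sum_filter, Finset.sum_const, smul_eq_mul]
    refine (Nat.mul_le_mul_right _ (Finset.card_le_one.2 ?_)).trans (one_mul _).le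
    intro w hw w' hw'
    simp only [Finset.mem_filter, Finset.mem_univ, true_and] at hw hw'
    exact eq_of_adj_of_dist_add_one hT hw.1 hw'.1 hw.2 hw'.2
  -- If `v` is the farther end, monotonicity replaces the weight of `w` by that of `v`. Each vertex
  -- pays only for its parent edge, in either order of the ends, whence the factor 2.
  calc _ ≤ ∑ v, ∑ w, ((if T.Adj v w ∧ T.dist v r = T.dist w r + 1 then f (T.degree v) else 0) +
        (if T.Adj w v ∧ T.dist w r = T.dist v r + 1 then f (T.degree w) else 0)) := by
        refine Finset.sum_le_sum fun v _ => ?_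
        rw [SimpleGraph.neighborFinset_eq_filter, Finset.filter_filter, Finset.sum_filter]
        refine Finset.sum_le_sum fun w _ => ?_
        by_cases h : T.Adj v w ∧ T.degree w ≤ T.degree v
        · rw [if_pos h]
          have hd := hT.dist_eq_dist_add_one_of_adj r h.1
          rw [T.dist_comm (u := r), T.dist_comm (u := r)] at hd
          rcases hd with hd | hd
          · rw [if_pos ⟨h.1, hd⟩]
            exact (hf h.2).trans (Nat.le_add_right _ _)
          · rw [if_pos (c := T.Adj w v ∧ _) ⟨h.1.symm, hd⟩]
            exact Nat.le_add_left _ _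
        · rw [if_neg h]; exact Nat.zero_le _
    _ ≤ _ := by
        simp_rw [Finset.sum_add_distrib]
        rw [two_mul]
        refine add_le_add hparent ?_
        rw [Finset.sum_comm]
        exact hparent

lemma mul_pow_le_pow_add_pow (a b n : ℕ) : a * b ^ n ≤ b ^ (n + 1) + a ^ (n + 1) := by
  rcases le_total a b with h | h
  · calc a * b ^ n ≤ b * b ^ n := by gcongr
      _ = b ^ (n + 1) := by ring
      _ ≤ _ := Nat.le_add_right _ _
  · calc a * b ^ n ≤ a * a ^ n := by gcongr
      _ = a ^ (n + 1) := by ring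
      _ ≤ _ := Nat.le_add_left _ _

/-- Up to a multiple of the number of vertices, the number of subtrees other than stars is an
arbitrarily small multiple of the degree moment. -/
lemma mul_numNonstars_le {V : Type*} [Fintype V] {T : SimpleGraph V} [DecidableRel T.Adj]
    (hT : T.IsTree) (n K : ℕ) :
    K * numNonstars (n + 3) T ≤ (n + 3) ^ n * (2 * ∑ v, T.degree v ^ (n + 2) +
      (2 * K ^ (n + 1)) ^ (n + 2) * Fintype.card V) := by
  -- The coefficient combines the `K ^ (n + 1)` from splitting the product with the 2 from charging
  -- edges.
  have hmoment : 2 * K ^ (n + 1) * ∑ v, T.degree v ^ (n + 1) ≤ ∑ v, T.degree v ^ (n + 2) +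
      (2 * K ^ (n + 1)) ^ (n + 2) * Fintype.card V := by
    calc _ = ∑ v, 2 * K ^ (n + 1) * T.degree v ^ (n + 1) := Finset.mul_sum _ _ _
      _ ≤ ∑ v, (T.degree v ^ (n + 2) + (2 * K ^ (n + 1)) ^ (n + 2)) :=
        Finset.sum_le_sum fun v _ => mul_pow_le_pow_add_pow _ _ _
      _ = _ := by rw [Finset.sum_add_distrib]; simp [mul_comm]
  have hlarge : ∑ v, ∑ w ∈ (T.neighborFinset v).filter (T.degree · ≤ T.degree v),
      T.degree v ^ (n + 1) ≤ ∑ v, T.degree v ^ (n + 2) := by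
    refine Finset.sum_le_sum fun v _ => ?_
    rw [Finset.sum_const, smul_eq_mul, pow_succ' _ (n + 1)]
    gcongr
    rw [← SimpleGraph.card_neighborFinset_eq_degree]
    exact Finset.card_filter_le _ _
  have hsmall := sum_neighbor_degree_le hT (f := fun d => d ^ (n + 1))
    fun a b h => Nat.pow_le_pow_left h _
  calc _ ≤ K * ∑ v, ∑ w ∈ (T.neighborFinset v).filter (T.degree · ≤ T.degree v),
        T.degree w * ((n + 3) * T.degree v) ^ n :=
        Nat.mul_le_mul_left _ (numNonstars_le hT.isAcyclic n)
    _ = (n + 3) ^ n * ∑ v, ∑ w ∈ (T.neighborFinset v).filter (T.degree · ≤ T.degree v),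
        (K * T.degree w) * T.degree v ^ n := by
        simp_rw [Finset.mul_sum]
        refine Finset.sum_congr rfl fun v _ => Finset.sum_congr rfl fun w _ => ?_
        rw [mul_pow]
        ring
    _ ≤ (n + 3) ^ n * ∑ v, ∑ w ∈ (T.neighborFinset v).filter (T.degree · ≤ T.degree v),
        (T.degree v ^ (n + 1) + K ^ (n + 1) * T.degree w ^ (n + 1)) := by
        gcongr with v _ w _
        rw [← mul_pow]
        exact mul_pow_le_pow_add_pow _ _ _
    _ ≤ _ := by
        gcongr
        simp_rw [Finset.sum_add_distrib, ← Finset.mul_sum]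
        nlinarith [Nat.mul_le_mul_left (K ^ (n + 1)) hsmall]

/-! ### Covering the tree by paths and thickening -/

/-- A vertex at distance at least `k - 1` from a vertex `r` lies on an induced path with `k`
vertices, an initial segment of a geodesic to `r`. -/
lemma exists_mem_induce_iso_path {V : Type*} {T : SimpleGraph V} (hT : T.IsTree) {k : ℕ}
    (hk : 1 ≤ k) {v r : V} (h : k ≤ T.dist v r + 1) :
    ∃ W : Finset V, v ∈ W ∧ Nonempty (T.induce (W : Set V) ≃g path k) := by
  classical
  obtain ⟨p, hp⟩ := hT.connected.exists_walk_length_eq_dist v r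
  -- Distance to `r` drops by exactly one per step, which gives both injectivity and the absence of
  -- chords.
  have hdist : ∀ i ≤ p.length, T.dist (p.getVert i) r + i = p.length := by
    intro i hi
    have h1 := T.dist_le (p.take i)
    have h2 := T.dist_le (p.drop i)
    have h3 := hT.connected.dist_triangle (u := v) (v := p.getVert i) (w := r)
    rw [SimpleGraph.Walk.take_length] at h1
    rw [SimpleGraph.Walk.drop_length] at h2
    omega
  let f : Fin k → V := fun i => p.getVert i
  have hf : ∀ i, T.dist (f i) r + i.val = p.length := fun i => hdist i (by omega)
  have hinj : Function.Injective f := by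
    intro i j hij
    have h1 := hf i
    have h2 := hf j
    rw [hij] at h1
    exact Fin.ext (by omega)
  have hadj : ∀ i j, T.Adj (f i) (f j) ↔ (path k).Adj i j := by
    intro i j
    rw [SimpleGraph.pathGraph_adj]
    constructor
    · intro hij
      have h1 := hf i
      have h2 := hf j
      have h3 := hT.dist_eq_dist_add_one_of_adj r hij
      rw [T.dist_comm (u := r), T.dist_comm (u := r)] at h3
      omega
    · rintro (hij | hij)
      · have := p.adj_getVert_succ (i := i) (by omega)
        rwa [hij] at this
      · have := p.adj_getVert_succ (i := j) (by omega)
        rw [hij] at this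
        exact this.symm
  refine ⟨Finset.univ.image f, Finset.mem_image.2 ⟨⟨0, hk⟩, Finset.mem_univ _, by simp [f]⟩, ⟨?_⟩⟩
  refine SimpleGraph.Iso.symm ⟨Equiv.ofBijective
    (fun i => ⟨f i, by simp⟩) ⟨fun i j hij => hinj (congrArg Subtype.val hij), ?_⟩, ?_⟩
  · rintro ⟨x, hx⟩
    obtain ⟨i, -, rfl⟩ := Finset.mem_image.1 (Finset.mem_coe.1 hx)
    exact ⟨i, rfl⟩
  · intro i j
    exact hadj i j

open Classical in
/-- The set of vertices at distance at most `i` from `B`. -/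
noncomputable def thickening {V : Type*} [Fintype V] (T : SimpleGraph V) [DecidableRel T.Adj]
    (B : Finset V) : ℕ → Finset V
  | 0 => B
  | i + 1 => (thickening T B i).biUnion fun v => insert v (T.neighborFinset v)

lemma mem_thickening_of_walk {V : Type*} [Fintype V] {T : SimpleGraph V} [DecidableRel T.Adj]
    {B : Finset V} {i : ℕ} : ∀ {v r : V} (p : T.Walk v r), r ∈ B → p.length ≤ i →
      v ∈ thickening T B i := by
  classical
  induction i with
  | zero =>
    intro v r p hr hp
    rwa [SimpleGraph.Walk.eq_of_length_eq_zero (Nat.le_zero.1 hp)]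
  | succ i ih =>
    intro v r p hr hp
    rw [thickening, Finset.mem_biUnion]
    cases p with
    | nil => exact ⟨v, ih .nil hr (by simp), by simp⟩
    | cons h q => exact ⟨_, ih q hr (by simpa using hp), by simp [h.symm]⟩

/-- Cauchy–Schwarz applied to the sizes of the closed neighbourhoods. -/
lemma card_thickening_succ_sq_le {V : Type*} [Fintype V] (T : SimpleGraph V) [DecidableRel T.Adj]
    (B : Finset V) (i : ℕ) : (thickening T B (i + 1)).card ^ 2 ≤
      (thickening T B i).card * (2 * (∑ v, T.degree v ^ 2 + Fintype.card V)) := by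
  classical
  have h1 : (thickening T B (i + 1)).card ≤ ∑ v ∈ thickening T B i, (T.degree v + 1) := by
    refine Finset.card_biUnion_le.trans (Finset.sum_le_sum fun v _ => ?_)
    refine (Finset.card_insert_le _ _).trans ?_
    rw [SimpleGraph.card_neighborFinset_eq_degree]
  calc _ ≤ (∑ v ∈ thickening T B i, (T.degree v + 1)) ^ 2 := Nat.pow_le_pow_left h1 2
    _ ≤ (thickening T B i).card * ∑ v ∈ thickening T B i, (T.degree v + 1) ^ 2 := by
      zify
      exact sq_sum_le_card_mul_sum_sq
    _ ≤ (thickening T B i).card * ∑ v, (T.degree v + 1) ^ 2 := by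
      gcongr
      exact Finset.subset_univ _
    _ ≤ _ := by
      gcongr
      calc ∑ v, (T.degree v + 1) ^ 2 ≤ ∑ v, 2 * (T.degree v ^ 2 + 1) := by
            gcongr with v
            zify
            nlinarith [sq_nonneg ((T.degree v : ℤ) - 1)]
        _ = _ := by rw [← Finset.mul_sum, Finset.sum_add_distrib]; simp

/-- There is a set of vertices, not much larger than the number of paths with `k` vertices,
from which every vertex of the tree has distance at most `k`. -/
lemma exists_thickening_eq_univ {V : Type*} [Fintype V] {T : SimpleGraph V} [DecidableRel T.Adj]
    (hT : T.IsTree) {k : ℕ} (hk : 1 ≤ k) : ∃ B : Finset V,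
      B.card ≤ copies (path k) T * k + 1 ∧ thickening T B k = Finset.univ := by
  classical
  obtain ⟨r⟩ := hT.connected.nonempty
  -- All vertices on `k`-vertex paths, and the root `r` to serve the vertices too close to it to
  -- start such a path.
  refine ⟨insert r ((Finset.univ.filter fun W : Finset V =>
    Nonempty (T.induce (W : Set V) ≃g path k)).biUnion id), ?_, ?_⟩
  · refine (Finset.card_insert_le _ _).trans (Nat.add_le_add_right ?_ 1)
    refine Finset.card_biUnion_le_card_mul _ _ _ fun W hW => ?_
    rw [id, card_eq_of_induce_iso (Finset.mem_filter.1 hW).2, Fintype.card_fin]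
  · refine Finset.eq_univ_iff_forall.2 fun v => ?_
    by_cases h : k ≤ T.dist v r + 1
    · obtain ⟨W, hv, hW⟩ := exists_mem_induce_iso_path hT hk h
      refine mem_thickening_of_walk (SimpleGraph.Walk.nil : T.Walk v v) ?_ (by simp)
      exact Finset.mem_insert_of_mem (Finset.mem_biUnion.2 ⟨W, by simpa using hW, hv⟩)
    · obtain ⟨p, hp⟩ := hT.connected.exists_walk_length_eq_dist v r
      exact mem_thickening_of_walk p (Finset.mem_insert_self _ _) (by omega)

/-! ### Proportions and limits -/

lemma pathProportion_nonneg {V : Type*} [Fintype V] (k : ℕ) (T : SimpleGraph V) :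
    0 ≤ pathProportion k T := by
  unfold pathProportion proportion; positivity

lemma pathProportion_mul_numSubtrees {V : Type*} [Fintype V] {T : SimpleGraph V}
    (hT : T.IsAcyclic) {k : ℕ} (hk : 4 ≤ k) :
    pathProportion k T * numSubtrees k T = copies (path k) T := by
  have h1 := copies_path_le_numNonstars hT hk
  have h2 := copies_star_add_numNonstars T (k := k) (by omega)
  -- Without `k`-vertex subtrees the proportion is 0 by convention, and there are no paths either.
  rcases Nat.eq_zero_or_pos (numSubtrees k T) with h | h
  · simp [h, show copies (path k) T = 0 by omega]
  · unfold pathProportion proportion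
    field_simp

lemma pathProportion_le_one_sub_starProportion {V : Type*} [Fintype V] {T : SimpleGraph V}
    (hT : T.IsAcyclic) {k : ℕ} (hk : 4 ≤ k) :
    pathProportion k T ≤ 1 - starProportion k T := by
  have h1 := copies_path_le_numNonstars hT hk
  have h2 := copies_star_add_numNonstars T (k := k) (by omega)
  rw [le_sub_iff_add_le, pathProportion, starProportion, proportion, proportion, ← add_div]
  refine div_le_one_of_le₀ ?_ (Nat.cast_nonneg _)
  exact_mod_cast (by omega : copies (path k) T + copies (star k) T ≤ numSubtrees k T)

section Sequences

variable {V : ℕ → Type*} [∀ n, Fintype (V n)] {T : ∀ n, SimpleGraph (V n)}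
  [∀ n, DecidableRel (T n).Adj] {l : Filter ℕ}

/-- If the second degree moments are bounded on average, sets of vertices of vanishing proportion
have thickenings of vanishing proportion. -/
lemma tendsto_card_thickening_div (hN : ∀ᶠ n in l, 0 < Fintype.card (V n)) {C : ℝ}
    (hC : ∀ᶠ n in l, ∑ v, ((T n).degree v : ℝ) ^ 2 ≤ C * Fintype.card (V n))
    {B : ∀ n, Finset (V n)}
    (hB : Tendsto (fun n => ((B n).card : ℝ) / Fintype.card (V n)) l (𝓝 0)) (i : ℕ) :
    Tendsto (fun n => ((thickening (T n) (B n) i).card : ℝ) / Fintype.card (V n)) l (𝓝 0) := by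
  induction i with
  | zero => exact hB
  | succ i ih =>
    have hlim := (ih.mul_const (2 * (C + 1))).sqrt
    rw [zero_mul, Real.sqrt_zero] at hlim
    refine tendsto_of_tendsto_of_tendsto_of_le_of_le' tendsto_const_nhds hlim
      (Eventually.of_forall fun n => by positivity) ?_
    filter_upwards [hN, hC] with n hn hCn
    have hn' : (0 : ℝ) < Fintype.card (V n) := by exact_mod_cast hn
    have h := card_thickening_succ_sq_le (T n) (B n) i
    have h' : ((thickening (T n) (B n) (i + 1)).card : ℝ) ^ 2 ≤
      (thickening (T n) (B n) i).card *
        (2 * (∑ v, ((T n).degree v : ℝ) ^ 2 + Fintype.card (V n))) := by exact_mod_cast h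
    apply Real.le_sqrt_of_sq_le
    rw [div_pow, div_le_iff₀ (by positivity)]
    calc _ ≤ _ := h'
      _ ≤ (thickening (T n) (B n) i).card *
        (2 * (C * Fintype.card (V n) + Fintype.card (V n))) := by gcongr
      _ = _ := by field_simp

lemma tendsto_numSubtrees_of_tendsto_pathProportion (hT : ∀ n, (T n).IsTree)
    (hsize : Tendsto (fun n => Fintype.card (V n)) atTop atTop) {k : ℕ} (hk : 4 ≤ k)
    (h : Tendsto (fun n => pathProportion k (T n)) atTop (𝓝 0)) :
    Tendsto (fun n => 1 / (Fintype.card (V n) : ℝ) * (numSubtrees k (T n) : ℝ)) atTop atTop := by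
  by_contra hnot
  rw [tendsto_atTop] at hnot
  push Not at hnot
  obtain ⟨b, hb⟩ := hnot
  let s : Set ℕ := {n | 1 / (Fintype.card (V n) : ℝ) * (numSubtrees k (T n) : ℝ) < b}
  -- Restricting the filter to `s` plays the role of passing to a subsequence.
  have : (atTop ⊓ 𝓟 s).NeBot := frequently_mem_iff_neBot.1 hb
  have hl : atTop ⊓ 𝓟 s ≤ atTop := inf_le_left
  have hNpos : ∀ n, (0 : ℝ) < Fintype.card (V n) := fun n => by
    have := (hT n).connected.nonempty
    exact_mod_cast Fintype.card_pos
  have hs : ∀ᶠ n in atTop ⊓ 𝓟 s, (numSubtrees k (T n) : ℝ) ≤ b * Fintype.card (V n) := by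
    filter_upwards [mem_inf_of_right (mem_principal_self s)] with n hn
    have hn : 1 / (Fintype.card (V n) : ℝ) * (numSubtrees k (T n) : ℝ) < b := hn
    rw [one_div_mul_eq_div, div_lt_iff₀ (hNpos n)] at hn
    exact hn.le
  have hmoment : ∀ᶠ n in atTop ⊓ 𝓟 s, ∑ v, ((T n).degree v : ℝ) ^ 2 ≤
      ((2 ^ (k - 1) * (k - 1).factorial * k : ℕ) * b + ((2 * (k - 1)) ^ (k - 1) : ℕ)) *
        Fintype.card (V n) := by
    filter_upwards [hs] with n hn
    have h1 : ∑ v, (T n).degree v ^ 2 ≤ ∑ v, (T n).degree v ^ (k - 1) := by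
      refine Finset.sum_le_sum fun v _ => ?_
      rcases Nat.eq_zero_or_pos ((T n).degree v) with h0 | h0
      · simp [h0]
      · exact Nat.pow_le_pow_right h0 (by omega)
    have h2 := sum_degree_pow_le (hT n).isAcyclic (k := k) (by omega)
    have h3 := copies_star_add_numNonstars (T n) (k := k) (by omega)
    have h4 := (h1.trans h2).trans (Nat.add_le_add_right
      (Nat.mul_le_mul_left _ (by omega : copies (star k) (T n) ≤ numSubtrees k (T n))) _)
    have h5 : ∑ v, ((T n).degree v : ℝ) ^ 2 ≤
        (2 ^ (k - 1) * (k - 1).factorial * k : ℕ) * (numSubtrees k (T n) : ℝ) +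
        ((2 * (k - 1)) ^ (k - 1) : ℕ) * Fintype.card (V n) := by exact_mod_cast h4
    have h6 : ((2 ^ (k - 1) * (k - 1).factorial * k : ℕ) : ℝ) * (numSubtrees k (T n) : ℝ) ≤
        (2 ^ (k - 1) * (k - 1).factorial * k : ℕ) * (b * Fintype.card (V n)) :=
      mul_le_mul_of_nonneg_left hn (Nat.cast_nonneg _)
    linarith
  choose B hBcard hBuniv using fun n => exists_thickening_eq_univ (hT n) (k := k) (by omega)
  have hlim : Tendsto (fun n => pathProportion k (T n) * b * k + (Fintype.card (V n) : ℝ)⁻¹)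
      (atTop ⊓ 𝓟 s) (𝓝 0) := by
    have h1 := ((h.mul_const b).mul_const (k : ℝ)).add
      (tendsto_inv_atTop_zero.comp (tendsto_natCast_atTop_atTop (R := ℝ) |>.comp hsize))
    simp only [zero_mul, zero_add] at h1
    exact h1.mono_left hl
  have hB : Tendsto (fun n => ((B n).card : ℝ) / Fintype.card (V n)) (atTop ⊓ 𝓟 s) (𝓝 0) := by
    refine tendsto_of_tendsto_of_tendsto_of_le_of_le' tendsto_const_nhds hlim
      (Eventually.of_forall fun n => by positivity) ?_
    filter_upwards [hs] with n hn
    have hcard : ((B n).card : ℝ) ≤ copies (path k) (T n) * k + 1 := by exact_mod_cast hBcard n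
    rw [← pathProportion_mul_numSubtrees (hT n).isAcyclic hk] at hcard
    rw [div_le_iff₀ (hNpos n), add_mul, inv_mul_cancel₀ (hNpos n).ne']
    have := mul_le_mul_of_nonneg_right (mul_le_mul_of_nonneg_left hn
      (pathProportion_nonneg k (T n))) (Nat.cast_nonneg (α := ℝ) k)
    linarith
  have hend := tendsto_card_thickening_div
    (Eventually.of_forall fun n => by exact_mod_cast hNpos n) hmoment hB k
  have hone : (fun n => ((thickening (T n) (B n) k).card : ℝ) / Fintype.card (V n)) =
      fun _ => 1 := by
    funext n
    rw [hBuniv, Finset.card_univ, div_self (hNpos n).ne']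
  rw [hone] at hend
  exact one_ne_zero (tendsto_nhds_unique tendsto_const_nhds hend)

lemma tendsto_degree_moment_of_tendsto_numSubtrees {k : ℕ} (hk : 1 ≤ k)
    (h : Tendsto (fun n => 1 / (Fintype.card (V n) : ℝ) * (numSubtrees k (T n) : ℝ))
      atTop atTop) :
    Tendsto (fun n => 1 / (Fintype.card (V n) : ℝ) *
      ∑ v : V n, ((T n).degree v : ℝ) ^ (k - 1)) atTop atTop := by
  have hc : (0 : ℝ) < (k : ℝ) ^ (k - 1) := by positivity
  refine tendsto_atTop_mono (fun n => ?_) (h.const_mul_atTop (inv_pos.2 hc))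
  have h1 : (numSubtrees k (T n) : ℝ) ≤ (k : ℝ) ^ (k - 1) *
      ∑ v, ((T n).degree v : ℝ) ^ (k - 1) := by exact_mod_cast numSubtrees_le (T n) hk
  rw [mul_left_comm]
  gcongr
  rwa [inv_mul_le_iff₀ hc]

lemma tendsto_starProportion_of_tendsto_degree_moment (hT : ∀ n, (T n).IsTree)
    {k : ℕ} (hk : 3 ≤ k)
    (h : Tendsto (fun n => 1 / (Fintype.card (V n) : ℝ) *
      ∑ v : V n, ((T n).degree v : ℝ) ^ (k - 1)) atTop atTop) :
    Tendsto (fun n => starProportion k (T n)) atTop (𝓝 1) := by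
  obtain ⟨m, rfl⟩ : ∃ m, k = m + 3 := ⟨k - 3, by omega⟩
  simp only [show m + 3 - 1 = m + 2 from rfl] at h
  have hNpos : ∀ n, (0 : ℝ) < Fintype.card (V n) := fun n => by
    have := (hT n).connected.nonempty
    exact_mod_cast Fintype.card_pos
  have hlarge : ∀ c : ℝ, ∀ᶠ n in atTop, c * Fintype.card (V n) ≤
      ∑ v, ((T n).degree v : ℝ) ^ (m + 2) := fun c => by
    filter_upwards [h.eventually_ge_atTop c] with n hn
    rwa [one_div_mul_eq_div, le_div_iff₀ (hNpos n)] at hn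
  obtain ⟨c₁, c₂, hstar⟩ : ∃ c₁ c₂ : ℕ, ∀ n, ∑ v, ((T n).degree v : ℝ) ^ (m + 2) ≤
      c₁ * copies (star (m + 3)) (T n) + c₂ * Fintype.card (V n) :=
    ⟨_, _, fun n => by
      exact_mod_cast sum_degree_pow_le (hT n).isAcyclic (k := m + 3) (by omega)⟩
  -- Once the moment is at least `2 * c₂` per vertex, the vertex term is at most half of it.
  have hmoment : ∀ᶠ n in atTop, ∑ v, ((T n).degree v : ℝ) ^ (m + 2) ≤
      2 * c₁ * numSubtrees (m + 3) (T n) := by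
    filter_upwards [hlarge (2 * c₂)] with n hn
    have h1 := hstar n
    have h2 : (copies (star (m + 3)) (T n) : ℝ) ≤ numSubtrees (m + 3) (T n) := by
      have := copies_star_add_numNonstars (T n) (k := m + 3) (by omega)
      exact_mod_cast (by omega : copies (star (m + 3)) (T n) ≤ numSubtrees (m + 3) (T n))
    have h3 := mul_le_mul_of_nonneg_left h2 (Nat.cast_nonneg (α := ℝ) c₁)
    linarith
  have hpos : ∀ᶠ n in atTop, (0 : ℝ) < numSubtrees (m + 3) (T n) := by
    filter_upwards [hmoment, hlarge 1] with n h1 h2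
    have h3 : 0 < 2 * (c₁ : ℝ) * numSubtrees (m + 3) (T n) := by linarith [hNpos n]
    exact pos_of_mul_pos_right h3 (by positivity)
  have hzero : Tendsto (fun n => (numNonstars (m + 3) (T n) : ℝ) / numSubtrees (m + 3) (T n))
      atTop (𝓝 0) := by
    rw [tendsto_order]
    refine ⟨fun a ha => Eventually.of_forall fun n => ha.trans_le (by positivity),
      fun ε hε => ?_⟩
    -- Eventually the vertex term is at most one moment, so the bound is three moments, each at most
    -- `2 * c₁` times the number of subtrees.
    obtain ⟨K, hK⟩ := exists_nat_gt (6 * (m + 3 : ℝ) ^ m * c₁ / ε)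
    rw [div_lt_iff₀ hε] at hK
    have hKpos : (0 : ℝ) < K := pos_of_mul_pos_left (lt_of_le_of_lt (by positivity) hK) hε.le
    filter_upwards [hmoment, hpos, hlarge ((2 * (K : ℝ) ^ (m + 1)) ^ (m + 2))] with n h1 h2 h3
    have h4 : (K : ℝ) * numNonstars (m + 3) (T n) ≤ (m + 3 : ℝ) ^ m *
        (2 * ∑ v, ((T n).degree v : ℝ) ^ (m + 2) +
          (2 * (K : ℝ) ^ (m + 1)) ^ (m + 2) * Fintype.card (V n)) := by
      exact_mod_cast mul_numNonstars_le (hT n) m K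
    rw [div_lt_iff₀ h2]
    refine lt_of_mul_lt_mul_left ?_ hKpos.le
    calc _ ≤ _ := h4
      _ ≤ (m + 3 : ℝ) ^ m * (6 * c₁ * numSubtrees (m + 3) (T n)) := by
        gcongr
        linarith
      _ = 6 * (m + 3 : ℝ) ^ m * c₁ * numSubtrees (m + 3) (T n) := by ring
      _ < K * ε * numSubtrees (m + 3) (T n) := by gcongr
      _ = _ := by ring
  have hsub := (tendsto_const_nhds (x := (1 : ℝ))).sub hzero
  rw [sub_zero] at hsub
  refine hsub.congr' ?_
  filter_upwards [hpos] with n hn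
  rw [starProportion, proportion, sub_eq_iff_eq_add, ← add_div, eq_div_iff hn.ne', one_mul]
  exact_mod_cast (copies_star_add_numNonstars (T n) (k := m + 3) (by omega)).symm

end Sequences

lemma tendsto_pathProportion_of_tendsto_starProportion {V : ℕ → Type*} [∀ n, Fintype (V n)]
    {T : ∀ n, SimpleGraph (V n)} (hT : ∀ n, (T n).IsTree) {k : ℕ} (hk : 4 ≤ k)
    (h : Tendsto (fun n => starProportion k (T n)) atTop (𝓝 1)) :
    Tendsto (fun n => pathProportion k (T n)) atTop (𝓝 0) := by
  have hsub := (tendsto_const_nhds (x := (1 : ℝ))).sub h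
  rw [sub_self] at hsub
  exact squeeze_zero (fun n => pathProportion_nonneg k (T n))
    (fun n => pathProportion_le_one_sub_starProportion (hT n).isAcyclic hk) hsub

end TreeProfile

theorem theorem1 {V : ℕ → Type*} [∀ n, Fintype (V n)] (T : ∀ n, SimpleGraph (V n))
    [∀ n, DecidableRel (T n).Adj] (hT : ∀ n, (T n).IsTree)
    (hsize : Tendsto (fun n => Fintype.card (V n)) atTop atTop) (k : ℕ) (hk : 4 ≤ k) :
    List.TFAE [
      Tendsto (fun n => TreeProfile.pathProportion k (T n)) atTop (𝓝 0),
      Tendsto (fun n => 1 / (Fintype.card (V n) : ℝ) * (TreeProfile.numSubtrees k (T n) : ℝ))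
        atTop atTop,
      Tendsto (fun n => 1 / (Fintype.card (V n) : ℝ) *
        ∑ v : V n, ((T n).degree v : ℝ) ^ (k - 1)) atTop atTop,
      Tendsto (fun n => TreeProfile.starProportion k (T n)) atTop (𝓝 1)] := by
  tfae_have 1 → 2 := TreeProfile.tendsto_numSubtrees_of_tendsto_pathProportion hT hsize hk
  tfae_have 2 → 3 := TreeProfile.tendsto_degree_moment_of_tendsto_numSubtrees (by omega)
  tfae_have 3 → 4 := TreeProfile.tendsto_starProportion_of_tendsto_degree_moment hT (by omega)
  tfae_have 4 → 1 := TreeProfile.tendsto_pathProportion_of_tendsto_starProportion hT hk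
  tfae_finish
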